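/- Let $G$ be a finite group, $c=(c_1,\dots,c_t)$ a tuple of distinct nontrivial conjugacy classes of $G$, and $\underline\xi=(\xi_1,\dots,\xi_t)$ a tuple of positive integers with sum $\xi$. For $n\ge 0$ let $\mathrm{Br}_{n\cdot\underline\xi}\subseteq \mathrm{Br}_{n\xi}$ be the coloured braid group (the preimage of the Young subgroup $\mathfrak S_{n\xi_1}\times\cdots\times\mathfrak S_{n\xi_t}$ of permutations preserving the colouring of the strands by conjugacy classes), acting on $\mathbf c^n=(c_1^{\xi_1}\times\cdots\times c_t^{\xi_t})^n\subseteq G^{n\xi}$ by the Hurwitz action $$\sigma_i\cdot(g_1,\dots,g_{n\xi})=(g_1,\dots,g_{i-1},\,g_ig_{i+1}g_i^{-1},\,g_i,\,g_{i+2},\dots,g_{n\xi}).$$ Let $\mathrm{Hur}^c_{G,n\cdot\underline\xi}=E\mathrm{Br}_{n\cdot\underline\xi}\times_{\mathrm{Br}_{n\cdot\underline\xi}}\mathbf c^n$ be the Hurwitz space of marked covers, let $G$ act on it by simultaneous conjugation of the entries of vectors in $\mathbf c^n$, and let $\mathcal H^c_{G,n\cdot\underline\xi}=\mathrm{Hur}^c_{G,n\cdot\underline\xi}/G$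 be the Hurwitz space of unmarked covers. Let $A$ be a field whose characteristic is zero or prime to $|G|$. Juxtaposition of braids and concatenation of vectors induce maps $\mathrm{Hur}^c_{G,m\cdot\underline\xi}\times\mathrm{Hur}^c_{G,n\cdot\underline\xi}\to\mathrm{Hur}^c_{G,(m+n)\cdot\underline\xi}$, which make $R=\bigoplus_{n\ge0}H_0(\mathrm{Hur}^c_{G,n\cdot\underline\xi};A)$ a graded ring and $\bigoplus_{n\ge 0}H_p(\mathrm{Hur}^c_{G,n\cdot\underline\xi};A)$ a graded left $R$-module for every $p\ge0$. Let $U\in R$ be a homogeneous element of degree $d$ that is invariant under the induced action of $G$ on $R$, and suppose that for every $p\ge 0$ there is a number $r(p)$ such that multiplication by $U$ is an isomorphism $$H_p(\mathrm{Hur}^c_{G,n\cdot\underline\xi};A)\xrightarrow{\ \sim\ }H_p(\mathrm{Hur}^c_{G,(n+d)\cdot\underline\xi};A)\qquad\text{for all } n\ge r(p).$$ Then for every $p\ge0$ and every $n\ge r(p)$ there is an isomorphism of $A$-vector spaces $$H_p(\mathcal H^c_{G,n\cdot\underline\xi};A)\cong H_p(\mathcal H^c_{G,(n+d)\cdot\underline\xi};A).$$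 -/

import Mathlib

universe u

namespace HurwitzSpace

open CategoryTheory AlgebraicTopology

/-! ### Artin braid groups -/

section Braid

/-- The Artin relations on generators `σ_0, …, σ_{N-2}`. -/
def braidRels (N : ℕ) : Set (FreeGroup (Fin (N - 1))) :=
  {r | (∃ i j : Fin (N - 1), (i : ℕ) + 1 = j ∧
          r = (FreeGroup.of i * FreeGroup.of j * FreeGroup.of i) *
            (FreeGroup.of j * FreeGroup.of i * FreeGroup.of j)⁻¹) ∨
       (∃ i j : Fin (N - 1), (i : ℕ) + 2 ≤ j ∧
          r = (FreeGroup.of i * FreeGroup.of j) * (FreeGroup.of j * FreeGroup.of i)⁻¹)}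

/-- The Artin braid group on `N` strands. -/
abbrev BraidGroup (N : ℕ) : Type := PresentedGroup (braidRels N)

/-- The generator `σ_i` of the braid group. -/
def braidGen {N : ℕ} (i : Fin (N - 1)) : BraidGroup N := PresentedGroup.of i

theorem braidGen_braid {N : ℕ} {i j : Fin (N - 1)} (h : (i : ℕ) + 1 = j) :
    braidGen i * braidGen j * braidGen i = braidGen j * braidGen i * braidGen j :=
  PresentedGroup.mk_eq_mk_of_mul_inv_mem (rels := braidRels N) (Or.inl ⟨i, j, h, rfl⟩)

theorem braidGen_comm {N : ℕ} {i j : Fin (N - 1)} (h : (i : ℕ) + 2 ≤ j) :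
    braidGen i * braidGen j = braidGen j * braidGen i :=
  PresentedGroup.mk_eq_mk_of_mul_inv_mem (rels := braidRels N) (Or.inr ⟨i, j, h, rfl⟩)

/-- The universal property of the braid group. -/
def braidLift {N : ℕ} {H : Type*} [Group H] (f : Fin (N - 1) → H)
    (h₁ : ∀ i j : Fin (N - 1), (i : ℕ) + 1 = j → f i * f j * f i = f j * f i * f j)
    (h₂ : ∀ i j : Fin (N - 1), (i : ℕ) + 2 ≤ j → f i * f j = f j * f i) :
    BraidGroup N →* H :=
  PresentedGroup.toGroup (f := f) (by
    rintro r (⟨i, j, h, rfl⟩ | ⟨i, j, h, rfl⟩)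
    · simp only [map_mul, map_inv, FreeGroup.lift_apply_of]
      rw [h₁ i j h, mul_inv_cancel]
    · simp only [map_mul, map_inv, FreeGroup.lift_apply_of]
      rw [h₂ i j h, mul_inv_cancel])

@[simp] theorem braidLift_gen {N : ℕ} {H : Type*} [Group H] (f : Fin (N - 1) → H) (h₁ h₂)
    (i : Fin (N - 1)) : braidLift f h₁ h₂ (braidGen i) = f i :=
  PresentedGroup.toGroup.of _

theorem braid_induction {N : ℕ} {p : BraidGroup N → Prop} (one : p 1)
    (gen : ∀ i, p (braidGen i)) (mul : ∀ x y, p x → p y → p (x * y))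
    (inv : ∀ x, p x → p x⁻¹) (x : BraidGroup N) : p x :=
  PresentedGroup.generated_by _
    ({ carrier := {x | p x}, one_mem' := one, mul_mem' := fun {a b} ha hb => mul a b ha hb,
       inv_mem' := fun {a} ha => inv a ha } : Subgroup (BraidGroup N)) gen x

/-- The position `i` moved by `σ_i`. -/
def lo {N : ℕ} (i : Fin (N - 1)) : Fin N := ⟨i, by omega⟩

/-- The position `i + 1` moved by `σ_i`. -/
def hi {N : ℕ} (i : Fin (N - 1)) : Fin N := ⟨i + 1, by omega⟩

/-- The surjection from the braid group to the symmetric group, `σ_i ↦ (i, i+1)`. -/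
def braidPerm (N : ℕ) : BraidGroup N →* Equiv.Perm (Fin N) :=
  braidLift (fun i => Equiv.swap (lo i) (hi i))
    (by
      intro i j h
      have h1 : hi i = lo j := Fin.ext h
      have h2 : lo i ≠ lo j := fun e => by simp [lo, Fin.ext_iff] at e; omega
      have h3 : lo i ≠ hi j := fun e => by simp [lo, hi, Fin.ext_iff] at e; omega
      have h4 : lo j ≠ hi j := fun e => by simp [lo, hi, Fin.ext_iff] at e
      rw [h1]
      ext k
      simp only [Equiv.Perm.mul_apply, Equiv.swap_apply_def]
      congr 1
      split_ifs <;> simp_all)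
    (by
      intro i j h
      have h1 : lo i ≠ lo j := fun e => by simp [lo, Fin.ext_iff] at e; omega
      have h2 : lo i ≠ hi j := fun e => by simp [lo, hi, Fin.ext_iff] at e; omega
      have h3 : hi i ≠ lo j := fun e => by simp [lo, hi, Fin.ext_iff] at e; omega
      have h4 : hi i ≠ hi j := fun e => by simp [hi, Fin.ext_iff] at e; omega
      ext k
      simp only [Equiv.Perm.mul_apply, Equiv.swap_apply_def]
      congr 1
      split_ifs <;> simp_all)

/-- The coloured braid group of a colouring of the strands: the preimage in the braid group of the
Young subgroup of colour-preserving permutations. -/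
def coloredBraidGroup {N : ℕ} {ι : Type*} (color : Fin N → ι) : Subgroup (BraidGroup N) where
  carrier := {b | ∀ k, color (braidPerm N b k) = color k}
  one_mem' := by intro k; simp
  mul_mem' := by
    intro a b ha hb k
    rw [map_mul, Equiv.Perm.mul_apply, ha, hb]
  inv_mem' := by
    intro a ha k
    have := ha ((braidPerm N a)⁻¹ k)
    rw [← Equiv.Perm.mul_apply, mul_inv_cancel, Equiv.Perm.one_apply] at this
    rw [map_inv, this]

/-- The inclusion of the braid group on `a` strands into the braid group on `b` strands which uses
the strands `k, …, k + a - 1`. -/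
def braidShift (k a b : ℕ) (h : k + a ≤ b) : BraidGroup a →* BraidGroup b :=
  braidLift (fun i => braidGen ⟨k + i, by omega⟩)
    (fun i j hij => braidGen_braid (by simp only; omega))
    (fun i j hij => braidGen_comm (by simp only; omega))

theorem braidShift_gen (k a b : ℕ) (h : k + a ≤ b) (i : Fin (a - 1)) :
    braidShift k a b h (braidGen i) = braidGen ⟨k + i, by omega⟩ := braidLift_gen _ _ _ _

theorem braidShift_commute {a b c : ℕ} (h : a + b = c) (x : BraidGroup a) (y : BraidGroup b) :
    Commute (braidShift 0 a c (by omega) x) (braidShift a b c (by omega) y) := by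
  induction x using braid_induction with
  | one => rw [map_one]; exact Commute.one_left _
  | mul x x' hx hx' => rw [map_mul]; exact hx.mul_left hx'
  | inv x hx => rw [map_inv]; exact hx.inv_left
  | gen i =>
    induction y using braid_induction with
    | one => rw [map_one]; exact Commute.one_right _
    | mul x x' hx hx' => rw [map_mul]; exact hx.mul_right hx'
    | inv x hx => rw [map_inv]; exact hx.inv_right
    | gen j =>
      rw [braidShift_gen, braidShift_gen]
      exact braidGen_comm (by simp only; omega)

/-- Juxtaposition of braids: the inclusion `Br_a × Br_b → Br_{a+b}`. -/
def braidJuxt {a b c : ℕ} (h : a + b = c) : BraidGroup a × BraidGroup b →* BraidGroup c :=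
  (braidShift 0 a c (by omega)).noncommCoprod (braidShift a b c (by omega))
    (fun x y => braidShift_commute h x y)

theorem braidPerm_shift (k a b : ℕ) (h : k + a ≤ b) (x : BraidGroup a) :
    (∀ i : Fin a, braidPerm b (braidShift k a b h x) ⟨k + i, by omega⟩ =
        ⟨k + braidPerm a x i, by omega⟩) ∧
      ∀ j : Fin b, ((j : ℕ) < k ∨ k + a ≤ j) → braidPerm b (braidShift k a b h x) j = j := by
  induction x using braid_induction with
  | one => simp
  | mul x y hx hy =>
    refine ⟨fun i => ?_, fun j hj => ?_⟩
    · rw [map_mul, map_mul, Equiv.Perm.mul_apply, hy.1, hx.1]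
      simp only [map_mul, Equiv.Perm.mul_apply]
    · rw [map_mul, map_mul, Equiv.Perm.mul_apply, hy.2 j hj, hx.2 j hj]
  | inv x hx =>
    refine ⟨fun i => ?_, fun j hj => ?_⟩
    · rw [map_inv, map_inv, Equiv.Perm.inv_eq_iff_eq, hx.1]
      simp
    · rw [map_inv, map_inv, Equiv.Perm.inv_eq_iff_eq, hx.2 j hj]
  | gen i =>
    rw [braidShift_gen]
    refine ⟨fun j => ?_, fun j hj => ?_⟩
    · simp only [braidPerm, braidLift_gen, Equiv.swap_apply_def, lo, hi, Fin.ext_iff]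
      split_ifs <;> simp_all <;> omega
    · simp only [braidPerm, braidLift_gen, Equiv.swap_apply_def, lo, hi, Fin.ext_iff]
      split_ifs <;> simp_all <;> omega

end Braid

/-! ### The Hurwitz action -/

section Hurwitz

variable {G : Type u} [Group G]

/-- The move `(…, g_i, g_{i+1}, …) ↦ (…, g_i g_{i+1} g_i⁻¹, g_i, …)`. -/
def hurwitzMove {N : ℕ} (i : Fin (N - 1)) : Equiv.Perm (Fin N → G) where
  toFun g k := if k = lo i then g (lo i) * g (hi i) * (g (lo i))⁻¹
    else if k = hi i then g (lo i) else g k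
  invFun g k := if k = lo i then g (hi i)
    else if k = hi i then (g (hi i))⁻¹ * g (lo i) * g (hi i) else g k
  left_inv g := by
    have h : hi i ≠ lo i := fun e => by simp [lo, hi, Fin.ext_iff] at e
    ext k
    by_cases h1 : k = lo i
    · subst h1; simp [h]
    · by_cases h2 : k = hi i
      · subst h2; simp [h, mul_assoc]
      · simp [h1, h2]
  right_inv g := by
    have h : hi i ≠ lo i := fun e => by simp [lo, hi, Fin.ext_iff] at e
    ext k
    by_cases h1 : k = lo i
    · subst h1; simp [h, mul_assoc]
    · by_cases h2 : k = hi i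
      · subst h2; simp [h]
      · simp [h1, h2]

theorem hurwitzMove_apply {N : ℕ} (i : Fin (N - 1)) (g : Fin N → G) (k : Fin N) :
    hurwitzMove i g k = if k = lo i then g (lo i) * g (hi i) * (g (lo i))⁻¹
      else if k = hi i then g (lo i) else g k := rfl

/-- The Hurwitz action of the braid group on tuples of group elements (a left action). -/
def hurwitzAction (G : Type u) [Group G] (N : ℕ) : BraidGroup N →* Equiv.Perm (Fin N → G) :=
  braidLift hurwitzMove
    (by
      intro i j h
      have h1 : hi i = lo j := Fin.ext h
      have h2 : lo j ≠ lo i := fun e => by simp [lo, Fin.ext_iff] at e; omega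
      have h3 : hi j ≠ lo i := fun e => by simp [lo, hi, Fin.ext_iff] at e; omega
      have h4 : hi j ≠ lo j := fun e => by simp [lo, hi, Fin.ext_iff] at e
      ext g k
      simp only [Equiv.Perm.mul_apply, hurwitzMove_apply, h1]
      by_cases k1 : k = lo i
      · subst k1; simp [h2, h3, h4, h2.symm, h3.symm, mul_assoc]
      · by_cases k2 : k = lo j
        · subst k2; simp [h2, h2.symm, h3, h3.symm, h4]
        · by_cases k3 : k = hi j
          · subst k3; simp [h2, h2.symm, h3, h3.symm, h4]
          · simp [k1, k2, k3])
    (by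
      intro i j h
      have h1 : lo j ≠ lo i := fun e => by simp [lo, Fin.ext_iff] at e; omega
      have h2 : hi j ≠ lo i := fun e => by simp [lo, hi, Fin.ext_iff] at e; omega
      have h3 : lo j ≠ hi i := fun e => by simp [lo, hi, Fin.ext_iff] at e; omega
      have h4 : hi j ≠ hi i := fun e => by simp [hi, Fin.ext_iff] at e; omega
      have h5 : hi i ≠ lo i := fun e => by simp [lo, hi, Fin.ext_iff] at e
      have h6 : hi j ≠ lo j := fun e => by simp [lo, hi, Fin.ext_iff] at e
      ext g k
      simp only [Equiv.Perm.mul_apply, hurwitzMove_apply]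
      by_cases k1 : k = lo i
      · subst k1; simp [h1.symm, h2.symm, h3.symm, h4.symm]
      · by_cases k2 : k = hi i
        · subst k2; simp [h1.symm, h2.symm, h3.symm, h4.symm]
        · by_cases k3 : k = lo j
          · subst k3; simp [h1, h2, h3, h4]
          · by_cases k4 : k = hi j
            · subst k4; simp [h1, h2, h3, h4]
            · simp [k1, k2, k3, k4])

@[simp] theorem hurwitzAction_gen {N : ℕ} (i : Fin (N - 1)) :
    hurwitzAction G N (braidGen i) = hurwitzMove i := braidLift_gen _ _ _ _

/-- The Hurwitz action permutes the conjugacy classes of the entries. -/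
theorem conjClass_hurwitzAction {N : ℕ} (b : BraidGroup N) :
    ∀ (g : Fin N → G) (k : Fin N),
      ConjClasses.mk (hurwitzAction G N b g (braidPerm N b k)) = ConjClasses.mk (g k) := by
  induction b using braid_induction with
  | one => simp
  | mul x y hx hy =>
    intro g k
    rw [map_mul, map_mul, Equiv.Perm.mul_apply, Equiv.Perm.mul_apply, hx, hy]
  | inv x hx =>
    intro g k
    have := hx ((hurwitzAction G N x)⁻¹ g) ((braidPerm N x)⁻¹ k)
    rw [← Equiv.Perm.mul_apply, ← Equiv.Perm.mul_apply, mul_inv_cancel, mul_inv_cancel] at this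
    rw [map_inv, map_inv]
    exact this.symm
  | gen i =>
    intro g k
    have h : hi i ≠ lo i := fun e => by simp [lo, hi, Fin.ext_iff] at e
    rw [hurwitzAction_gen, braidPerm, braidLift_gen, hurwitzMove_apply]
    by_cases k1 : k = lo i
    · subst k1; simp [h]
    · by_cases k2 : k = hi i
      · subst k2
        simp only [Equiv.swap_apply_right, if_true]
        rw [ConjClasses.mk_eq_mk_iff_isConj, isConj_comm, isConj_iff]
        exact ⟨_, rfl⟩
      · rw [Equiv.swap_apply_of_ne_of_ne k1 k2]; simp [k1, k2]

/-- The Hurwitz action commutes with simultaneous conjugation. -/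
theorem hurwitzAction_conj {N : ℕ} (b : BraidGroup N) (x : G) :
    ∀ g : Fin N → G, hurwitzAction G N b (fun k => x * g k * x⁻¹) =
      fun k => x * hurwitzAction G N b g k * x⁻¹ := by
  induction b using braid_induction with
  | one => simp
  | mul a b ha hb =>
    intro g
    rw [map_mul, Equiv.Perm.mul_apply, Equiv.Perm.mul_apply, hb, ha]
  | inv a ha =>
    intro g
    rw [map_inv, Equiv.Perm.inv_eq_iff_eq, ha, ← Equiv.Perm.mul_apply, mul_inv_cancel]
    rfl
  | gen i =>
    intro g
    ext k
    simp only [hurwitzAction_gen, hurwitzMove_apply]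
    split_ifs <;> group

/-- Concatenation of tuples. -/
def concat {a b c : ℕ} (h : a + b = c) (g : Fin a → G) (g' : Fin b → G) : Fin c → G :=
  fun k => if hk : (k : ℕ) < a then g ⟨k, hk⟩ else g' ⟨k - a, by omega⟩

theorem hurwitzAction_concat_left {a b c : ℕ} (h : a + b = c) (x : BraidGroup a) :
    ∀ (g : Fin a → G) (g' : Fin b → G),
      hurwitzAction G c (braidShift 0 a c (by omega) x) (concat h g g') =
        concat h (hurwitzAction G a x g) g' := by
  induction x using braid_induction with
  | one => simp
  | mul x y hx hy =>
    intro g g'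
    rw [map_mul, map_mul, Equiv.Perm.mul_apply, hy, hx, map_mul, Equiv.Perm.mul_apply]
  | inv x hx =>
    intro g g'
    rw [map_inv, map_inv, Equiv.Perm.inv_eq_iff_eq, hx, map_inv, ← Equiv.Perm.mul_apply,
      mul_inv_cancel]
    rfl
  | gen i =>
    intro g g'
    rw [braidShift_gen, hurwitzAction_gen, hurwitzAction_gen]
    ext k
    have e1 : (i : ℕ) < a := by omega
    have e2 : (i : ℕ) + 1 < a := by omega
    by_cases hk : (k : ℕ) < a
    · simp [hurwitzMove_apply, concat, lo, hi, Fin.ext_iff, hk, e1, e2]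
    · have n1 : ¬ (k : ℕ) = i := by omega
      have n2 : ¬ (k : ℕ) = i + 1 := by omega
      simp [hurwitzMove_apply, concat, lo, hi, Fin.ext_iff, hk, n1, n2]

theorem hurwitzAction_concat_right {a b c : ℕ} (h : a + b = c) (x : BraidGroup b) :
    ∀ (g : Fin a → G) (g' : Fin b → G),
      hurwitzAction G c (braidShift a b c (by omega) x) (concat h g g') =
        concat h g (hurwitzAction G b x g') := by
  induction x using braid_induction with
  | one => simp
  | mul x y hx hy =>
    intro g g'
    rw [map_mul, map_mul, Equiv.Perm.mul_apply, hy, hx, map_mul, Equiv.Perm.mul_apply]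
  | inv x hx =>
    intro g g'
    rw [map_inv, map_inv, Equiv.Perm.inv_eq_iff_eq, hx, map_inv, ← Equiv.Perm.mul_apply,
      mul_inv_cancel]
    rfl
  | gen i =>
    intro g g'
    rw [braidShift_gen, hurwitzAction_gen, hurwitzAction_gen]
    ext k
    have e3 : a + (i : ℕ) + 1 - a = i + 1 := by omega
    have e4 : ¬ a + (i : ℕ) + 1 < a := by omega
    by_cases hk : (k : ℕ) < a
    · have n1 : ¬ (k : ℕ) = a + i := by omega
      have n2 : ¬ (k : ℕ) = a + i + 1 := by omega
      simp [hurwitzMove_apply, concat, lo, hi, Fin.ext_iff, hk, n1, n2]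
    · have n1 : (k : ℕ) = a + i ↔ (k : ℕ) - a = i := by omega
      have n2 : (k : ℕ) = a + i + 1 ↔ (k : ℕ) - a = i + 1 := by omega
      simp [hurwitzMove_apply, concat, lo, hi, Fin.ext_iff, hk, e3, e4, n1, n2]

theorem hurwitzAction_concat {a b c : ℕ} (h : a + b = c) (x : BraidGroup a × BraidGroup b)
    (g : Fin a → G) (g' : Fin b → G) :
    hurwitzAction G c (braidJuxt h x) (concat h g g') =
      concat h (hurwitzAction G a x.1 g) (hurwitzAction G b x.2 g') := by
  rw [braidJuxt, MonoidHom.noncommCoprod_apply, map_mul, Equiv.Perm.mul_apply,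
    hurwitzAction_concat_right, hurwitzAction_concat_left]

end Hurwitz

/-! ### A model of the universal space `EΓ`: Milnor's infinite join -/

section Join

open Convexity

/-- Probability weights on a set, with the topology of coordinatewise convergence. -/
instance instTopologicalSpaceStdSimplex (M : Type) : TopologicalSpace (StdSimplex ℝ M) :=
  TopologicalSpace.induced (fun w a => w.weights a) Pi.topologicalSpace

theorem continuous_weight {M : Type} (a : M) :
    Continuous (fun w : StdSimplex ℝ M => w.weights a) :=
  (continuous_apply a).comp continuous_induced_dom

theorem continuous_stdSimplex_iff {X : Type*} {M : Type} [TopologicalSpace X]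
    {f : X → StdSimplex ℝ M} : Continuous f ↔ ∀ a, Continuous fun x => (f x).weights a := by
  rw [continuous_induced_rng, continuous_pi_iff]
  rfl

theorem sum_filter_le {M : Type} [DecidableEq M] (w : StdSimplex ℝ M) (F : Finset M)
    (p : M → Prop) [DecidablePred p] :
    ∑ a ∈ F with p a, w.weights a ≤ ∑ a ∈ w.weights.support with p a, w.weights a := by
  calc ∑ a ∈ F with p a, w.weights a
      ≤ ∑ a ∈ F ∪ w.weights.support with p a, w.weights a :=
        Finset.sum_le_sum_of_subset_of_nonneg
          (Finset.filter_subset_filter _ Finset.subset_union_left) (fun i _ _ => w.nonneg i)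
    _ = _ := (Finset.sum_subset (Finset.filter_subset_filter _ Finset.subset_union_right)
        (by
          intro x hx hx'
          simp only [Finset.mem_filter, Finsupp.mem_support_iff, not_and] at hx hx'
          by_contra h
          exact hx' h hx.2)).symm

theorem map_weights_apply {M N : Type} [DecidableEq N] (f : M → N) (w : StdSimplex ℝ M) (b : N) :
    (w.map f).weights b = ∑ a ∈ w.weights.support with f a = b, w.weights a := by
  rw [StdSimplex.weights_map, Finsupp.mapDomain, Finsupp.sum_apply, Finsupp.sum, Finset.sum_filter]
  simp only [Finsupp.single_apply]

theorem continuous_map {M N : Type} (f : M → N) :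
    Continuous (StdSimplex.map f : StdSimplex ℝ M → StdSimplex ℝ N) := by
  classical
  rw [continuous_stdSimplex_iff]
  intro b
  have key : ∀ w : StdSimplex ℝ M, (w.map f).weights b =
      ∑ a ∈ w.weights.support with f a = b, w.weights a := fun w => map_weights_apply f w b
  have tot : ∀ w : StdSimplex ℝ M, (∑ a ∈ w.weights.support with f a = b, w.weights a) +
      ∑ a ∈ w.weights.support with ¬ f a = b, w.weights a = 1 := by
    intro w
    rw [Finset.sum_filter_add_sum_filter_not]
    exact w.total
  rw [continuous_iff_continuousAt]
  intro w₀
  have cont : ∀ p : M → Prop, ∀ [DecidablePred p], Continuous fun w : StdSimplex ℝ M =>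
      ∑ a ∈ w₀.weights.support with p a, w.weights a := by
    intro p _
    exact continuous_finsetSum _ fun a _ => continuous_weight a
  have l1 := (cont (fun a => f a = b)).tendsto w₀
  have l2 := (continuous_const.sub (cont (fun a => ¬ f a = b)) (X := StdSimplex ℝ M)
    (f := fun _ => (1 : ℝ))).tendsto w₀
  have e := tot w₀
  simp only [Pi.sub_apply] at l2
  rw [show (1 : ℝ) - ∑ a ∈ w₀.weights.support with ¬ f a = b, w₀.weights a =
    ∑ a ∈ w₀.weights.support with f a = b, w₀.weights a by linarith] at l2
  rw [ContinuousAt, key w₀]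
  refine tendsto_of_tendsto_of_tendsto_of_le_of_le l1 l2 (fun w => ?_) (fun w => ?_)
  · simp only [key]
    exact sum_filter_le w _ _
  · simp only [key, Pi.sub_apply]
    have h1 := tot w
    have h2 := sum_filter_le w w₀.weights.support (fun a => ¬ f a = b)
    linarith

/-- The product of two probability weights. -/
noncomputable def prodWeights {M N : Type} (x : StdSimplex ℝ M) (y : StdSimplex ℝ N) :
    StdSimplex ℝ (M × N) where
  weights := Finsupp.onFinset (x.weights.support ×ˢ y.weights.support)
    (fun p => x.weights p.1 * y.weights p.2) (by
      intro p hp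
      rw [Finset.mem_product, Finsupp.mem_support_iff, Finsupp.mem_support_iff]
      exact ⟨left_ne_zero_of_mul hp, right_ne_zero_of_mul hp⟩)
  nonneg := fun p => mul_nonneg (x.nonneg p.1) (y.nonneg p.2)
  total := by
    rw [Finsupp.onFinset_sum _ (fun _ => rfl), Finset.sum_product, ← Finset.sum_mul_sum]
    have h1 : ∑ i ∈ x.weights.support, x.weights i = 1 := x.total
    have h2 : ∑ i ∈ y.weights.support, y.weights i = 1 := y.total
    rw [h1, h2, one_mul]

theorem prodWeights_apply {M N : Type} (x : StdSimplex ℝ M) (y : StdSimplex ℝ N) (p : M × N) :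
    (prodWeights x y).weights p = x.weights p.1 * y.weights p.2 := rfl

theorem prodWeights_map {M N M' N' : Type} (x : StdSimplex ℝ M) (y : StdSimplex ℝ N)
    (f : M → M') (g : N → N') :
    prodWeights (x.map f) (y.map g) = (prodWeights x y).map (Prod.map f g) := by
  classical
  ext ⟨a, b⟩
  rw [prodWeights_apply, map_weights_apply, map_weights_apply, map_weights_apply, Finset.sum_mul_sum, ← Finset.sum_product']
  refine (Finset.sum_subset ?_ ?_).symm
  · rintro ⟨c, d⟩ h
    simp only [Finset.mem_filter, Finsupp.mem_support_iff, prodWeights_apply, Prod.map_apply,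
      Prod.mk.injEq, Finset.mem_product] at h ⊢
    exact ⟨⟨left_ne_zero_of_mul h.1, h.2.1⟩, right_ne_zero_of_mul h.1, h.2.2⟩
  · rintro ⟨c, d⟩ h h'
    simp only [Finset.mem_filter, Finsupp.mem_support_iff, prodWeights_apply, Prod.map_apply,
      Prod.mk.injEq, Finset.mem_product] at h h' ⊢
    by_contra h3
    exact h' ⟨h3, h.1.2, h.2.2⟩

/-- Milnor's infinite join `Γ * Γ * ⋯`: formal convex combinations `∑ tᵢ γᵢ` (`i ∈ ℕ`), finitely
supported, where `γᵢ ∈ Γ` is recorded only if `tᵢ ≠ 0`. Such a point is encoded by weights on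
`ℕ × Γ` which for every `i` are nonzero for at most one `γ`. The topology is Milnor's strong
topology. This is a contractible space with a free, properly discontinuous action of the discrete
group `Γ`. -/
def MilnorE (Γ : Type) : Type :=
  {x : StdSimplex ℝ (ℕ × Γ) // ∀ i γ γ', x.weights (i, γ) ≠ 0 → x.weights (i, γ') ≠ 0 → γ = γ'}

instance (Γ : Type) : TopologicalSpace (MilnorE Γ) := instTopologicalSpaceSubtype

theorem exists_of_map_ne_zero {M N : Type} (f : M → N) (w : StdSimplex ℝ M) (b : N)
    (h : (w.map f).weights b ≠ 0) : ∃ a, f a = b ∧ w.weights a ≠ 0 := by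
  classical
  rw [map_weights_apply] at h
  obtain ⟨a, ha, ha'⟩ := Finset.exists_ne_zero_of_sum_ne_zero h
  exact ⟨a, (Finset.mem_filter.1 ha).2, ha'⟩

/-- The left translation action of `Γ` on its infinite join. -/
noncomputable instance (Γ : Type) [Group Γ] : MulAction Γ (MilnorE Γ) where
  smul g x := ⟨x.1.map (fun p => (p.1, g * p.2)), by
    intro i γ γ' h h'
    obtain ⟨⟨j, a⟩, ha, ha'⟩ := exists_of_map_ne_zero _ _ _ h
    obtain ⟨⟨k, b⟩, hb, hb'⟩ := exists_of_map_ne_zero _ _ _ h'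
    simp only [Prod.mk.injEq] at ha hb
    obtain ⟨rfl, rfl⟩ := ha
    obtain ⟨rfl, rfl⟩ := hb
    rw [x.2 _ _ _ ha' hb']⟩
  one_smul x := Subtype.ext (by
    change StdSimplex.map _ x.1 = x.1
    simp only [one_mul]
    exact StdSimplex.map_id x.1)
  mul_smul _ _ x := Subtype.ext (by
    change StdSimplex.map _ x.1 = StdSimplex.map _ (StdSimplex.map _ x.1)
    rw [StdSimplex.map_map]
    simp only [mul_assoc])

theorem milnorE_smul_val {Γ : Type} [Group Γ] (g : Γ) (x : MilnorE Γ) :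
    (g • x).1 = x.1.map (fun p => (p.1, g * p.2)) := rfl

instance (Γ : Type) [Group Γ] : ContinuousConstSMul Γ (MilnorE Γ) where
  continuous_const_smul _ :=
    Continuous.subtype_mk ((continuous_map _).comp continuous_subtype_val) _

/-- For a homomorphism `Φ : Γ × Γ' → Λ`, the `Φ`-equivariant continuous map
`EΓ × EΓ' → E(Γ × Γ') → EΛ`, `(∑ sᵢ γᵢ, ∑ tⱼ γ'ⱼ) ↦ ∑ sᵢ tⱼ Φ(γᵢ, γ'ⱼ)`, where the pairs `(i, j)`
are enumerated by `ℕ`. -/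
noncomputable def milnorMul {Γ Γ' Λ : Type} [Group Γ] [Group Γ'] [Group Λ] (Φ : Γ × Γ' →* Λ)
    (z : MilnorE Γ × MilnorE Γ') : MilnorE Λ :=
  ⟨(prodWeights z.1.1 z.2.1).map (fun p => (Nat.pair p.1.1 p.2.1, Φ (p.1.2, p.2.2))), by
    intro i γ γ' h h'
    obtain ⟨⟨⟨j, a⟩, k, b⟩, ha, ha'⟩ := exists_of_map_ne_zero _ _ _ h
    obtain ⟨⟨⟨j', a₂⟩, k', b₂⟩, hb, hb'⟩ := exists_of_map_ne_zero _ _ _ h'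
    simp only [Prod.mk.injEq] at ha hb
    obtain ⟨e, rfl⟩ := ha
    obtain ⟨e', rfl⟩ := hb
    obtain ⟨rfl, rfl⟩ := Nat.pair_eq_pair.1 (e'.trans e.symm)
    rw [prodWeights_apply] at ha' hb'
    rw [z.1.2 _ _ _ (left_ne_zero_of_mul ha') (left_ne_zero_of_mul hb'),
      z.2.2 _ _ _ (right_ne_zero_of_mul ha') (right_ne_zero_of_mul hb')]⟩

theorem continuous_milnorMul {Γ Γ' Λ : Type} [Group Γ] [Group Γ'] [Group Λ] (Φ : Γ × Γ' →* Λ) :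
    Continuous (milnorMul Φ) := by
  refine Continuous.subtype_mk ((continuous_map _).comp
    (f := fun z : MilnorE Γ × MilnorE Γ' => prodWeights z.1.1 z.2.1) ?_) _
  rw [continuous_stdSimplex_iff]
  intro a
  simp only [prodWeights_apply]
  exact ((continuous_weight _).comp (continuous_subtype_val.comp continuous_fst)).mul
    ((continuous_weight _).comp (continuous_subtype_val.comp continuous_snd))

theorem milnorMul_smul {Γ Γ' Λ : Type} [Group Γ] [Group Γ'] [Group Λ] (Φ : Γ × Γ' →* Λ)
    (g : Γ × Γ') (x : MilnorE Γ) (y : MilnorE Γ') :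
    milnorMul Φ (g.1 • x, g.2 • y) = Φ g • milnorMul Φ (x, y) := by
  refine Subtype.ext ?_
  change StdSimplex.map _ (prodWeights (g.1 • x).1 (g.2 • y).1) =
    StdSimplex.map _ (StdSimplex.map _ (prodWeights x.1 y.1))
  rw [milnorE_smul_val, milnorE_smul_val, prodWeights_map, StdSimplex.map_map,
    StdSimplex.map_map]
  congr 1
  funext p
  simp only [Prod.map, ← map_mul]
  rfl

end Join

/-! ### Hurwitz spaces -/

section Spaces

variable {G : Type u} [Group G] {t : ℕ}

/-- The colour of a strand: the `n · (ξ_1 + ⋯ + ξ_t)` strands come in `n` consecutive blocks, each of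
which consists of `ξ_1` strands of colour `1`, then `ξ_2` strands of colour `2`, and so on. -/
def strandColor (ξ : Fin t → ℕ) (n : ℕ) (j : Fin (n * ∑ i, ξ i)) : Fin t :=
  (finSigmaFinEquiv.symm j.modNat).1

/-- The set `(c_1^{ξ_1} × ⋯ × c_t^{ξ_t})^n` of Hurwitz vectors, a discrete space. -/
def HurwitzVector (c : Fin t → ConjClasses G) (ξ : Fin t → ℕ) (n : ℕ) : Type u :=
  {g : Fin (n * ∑ i, ξ i) → G // ∀ j, ConjClasses.mk (g j) = c (strandColor ξ n j)}

instance (c : Fin t → ConjClasses G) (ξ : Fin t → ℕ) (n : ℕ) :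
    TopologicalSpace (HurwitzVector c ξ n) := ⊥

instance (c : Fin t → ConjClasses G) (ξ : Fin t → ℕ) (n : ℕ) :
    DiscreteTopology (HurwitzVector c ξ n) := ⟨rfl⟩

/-- The coloured braid group `Br_{n·ξ}`. -/
abbrev ColBraid (ξ : Fin t → ℕ) (n : ℕ) : Type := coloredBraidGroup (strandColor ξ n)

/-- The Hurwitz action of the coloured braid group on `(c_1^{ξ_1} × ⋯ × c_t^{ξ_t})^n`. -/
instance (c : Fin t → ConjClasses G) (ξ : Fin t → ℕ) (n : ℕ) :
    MulAction (ColBraid ξ n) (HurwitzVector c ξ n) where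
  smul b g := ⟨hurwitzAction G _ b.1 g.1, fun j => by
    have h := conjClass_hurwitzAction b.1 g.1 ((braidPerm _ b.1)⁻¹ j)
    have h' := b.2 ((braidPerm _ b.1)⁻¹ j)
    rw [← Equiv.Perm.mul_apply, mul_inv_cancel, Equiv.Perm.one_apply] at h h'
    rw [h, g.2, h']⟩
  one_smul g := Subtype.ext (by
    change hurwitzAction G _ 1 g.1 = g.1
    rw [map_one]; rfl)
  mul_smul a b g := Subtype.ext (by
    change hurwitzAction G _ (a.1 * b.1) g.1 = hurwitzAction G _ a.1 (hurwitzAction G _ b.1 g.1)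
    rw [map_mul]; rfl)

/-- The action of `G` on Hurwitz vectors by simultaneous conjugation. -/
instance (c : Fin t → ConjClasses G) (ξ : Fin t → ℕ) (n : ℕ) :
    MulAction G (HurwitzVector c ξ n) where
  smul x g := ⟨fun k => x * g.1 k * x⁻¹, fun j => by
    rw [← g.2 j, ConjClasses.mk_eq_mk_iff_isConj, isConj_comm, isConj_iff]
    exact ⟨x, rfl⟩⟩
  one_smul g := Subtype.ext (by
    change (fun k => 1 * g.1 k * 1⁻¹) = g.1
    simp)
  mul_smul x y g := Subtype.ext (by
    change (fun k => (x * y) * g.1 k * (x * y)⁻¹) = fun k => x * (y * g.1 k * y⁻¹) * x⁻¹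
    funext k
    group)

theorem braid_smul_conj_smul {c : Fin t → ConjClasses G} {ξ : Fin t → ℕ} {n : ℕ}
    (b : ColBraid ξ n) (x : G) (g : HurwitzVector c ξ n) : b • x • g = x • b • g :=
  Subtype.ext (hurwitzAction_conj b.1 x g.1)

instance (c : Fin t → ConjClasses G) (ξ : Fin t → ℕ) (n : ℕ) :
    ContinuousConstSMul (ColBraid ξ n) (HurwitzVector c ξ n) where
  continuous_const_smul _ := continuous_of_discreteTopology

instance (c : Fin t → ConjClasses G) (ξ : Fin t → ℕ) (n : ℕ) :
    ContinuousConstSMul G (HurwitzVector c ξ n) where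
  continuous_const_smul _ := continuous_of_discreteTopology

/-- The Hurwitz space for marked covers: the Borel construction
`EBr_{n·ξ} ×_{Br_{n·ξ}} (c_1^{ξ_1} × ⋯ × c_t^{ξ_t})^n`, i.e. the quotient of the product by the
diagonal action. -/
noncomputable def Hur (c : Fin t → ConjClasses G) (ξ : Fin t → ℕ) (n : ℕ) : Type u :=
  MulAction.orbitRel.Quotient (ColBraid ξ n) (MilnorE (ColBraid ξ n) × HurwitzVector c ξ n)

instance (c : Fin t → ConjClasses G) (ξ : Fin t → ℕ) (n : ℕ) : TopologicalSpace (Hur c ξ n) :=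
  inferInstanceAs (TopologicalSpace (Quotient _))

/-- The class of a point in the Borel construction. -/
noncomputable def Hur.mk {c : Fin t → ConjClasses G} {ξ : Fin t → ℕ} {n : ℕ}
    (z : MilnorE (ColBraid ξ n) × HurwitzVector c ξ n) : Hur c ξ n :=
  Quotient.mk (MulAction.orbitRel _ _) z

theorem Hur.isOpenQuotientMap_mk {c : Fin t → ConjClasses G} {ξ : Fin t → ℕ} {n : ℕ} :
    IsOpenQuotientMap (Hur.mk : _ → Hur c ξ n) :=
  MulAction.isOpenQuotientMap_quotientMk

/-- The action of `G` on the marked Hurwitz space induced by simultaneous conjugation. -/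
noncomputable instance (c : Fin t → ConjClasses G) (ξ : Fin t → ℕ) (n : ℕ) :
    MulAction G (Hur c ξ n) where
  smul x := Quotient.map (fun z => (z.1, x • z.2)) (by
    rintro _ z ⟨b, rfl⟩
    exact ⟨b, Prod.ext rfl (braid_smul_conj_smul b x z.2)⟩)
  one_smul := by
    rintro ⟨z⟩
    exact congrArg Hur.mk (Prod.ext rfl (one_smul G z.2))
  mul_smul x y := by
    rintro ⟨z⟩
    exact congrArg Hur.mk (Prod.ext rfl (mul_smul x y z.2))

theorem Hur.smul_mk {c : Fin t → ConjClasses G} {ξ : Fin t → ℕ} {n : ℕ} (x : G)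
    (z : MilnorE (ColBraid ξ n) × HurwitzVector c ξ n) :
    x • (Hur.mk z : Hur c ξ n) = Hur.mk (z.1, x • z.2) := rfl

instance (c : Fin t → ConjClasses G) (ξ : Fin t → ℕ) (n : ℕ) :
    ContinuousConstSMul G (Hur c ξ n) where
  continuous_const_smul x :=
    Hur.isOpenQuotientMap_mk.isQuotientMap.continuous_iff.2
      (Hur.isOpenQuotientMap_mk.continuous.comp
        (continuous_fst.prodMk ((continuous_const_smul x).comp continuous_snd)))

/-- The Hurwitz space for unmarked covers, the quotient of the marked one by the action of `G`. -/
noncomputable def UnmarkedHur (c : Fin t → ConjClasses G) (ξ : Fin t → ℕ) (n : ℕ) : Type u :=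
  MulAction.orbitRel.Quotient G (Hur c ξ n)

instance (c : Fin t → ConjClasses G) (ξ : Fin t → ℕ) (n : ℕ) :
    TopologicalSpace (UnmarkedHur c ξ n) :=
  inferInstanceAs (TopologicalSpace (Quotient _))

/-! ### The H-space structure -/

theorem strandColor_concat_left (ξ : Fin t → ℕ) (m n : ℕ) (j : Fin (m * ∑ i, ξ i))
    (k : Fin ((m + n) * ∑ i, ξ i)) (h : (k : ℕ) = j) :
    strandColor ξ (m + n) k = strandColor ξ m j := by
  have : k.modNat = j.modNat := Fin.ext (by simp [Fin.modNat, h])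
  rw [strandColor, this, strandColor]

theorem strandColor_concat_right (ξ : Fin t → ℕ) (m n : ℕ) (j : Fin (n * ∑ i, ξ i))
    (k : Fin ((m + n) * ∑ i, ξ i)) (h : (k : ℕ) = m * ∑ i, ξ i + j) :
    strandColor ξ (m + n) k = strandColor ξ n j := by
  have : k.modNat = j.modNat := Fin.ext (by simp [Fin.modNat, h, Nat.add_mod])
  rw [strandColor, this, strandColor]

/-- Juxtaposition of coloured braids: the inclusion `Br_{m·ξ} × Br_{n·ξ} → Br_{(m+n)·ξ}`. -/
def colBraidJuxt (ξ : Fin t → ℕ) (m n : ℕ) : ColBraid ξ m × ColBraid ξ n →* ColBraid ξ (m + n) :=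
  ((braidJuxt (Nat.add_mul m n (∑ i, ξ i)).symm).comp
    ((coloredBraidGroup (strandColor ξ m)).subtype.prodMap
      (coloredBraidGroup (strandColor ξ n)).subtype)).codRestrict _ (by
    rintro ⟨x, y⟩ k
    have hmn := Nat.add_mul m n (∑ i, ξ i)
    simp only [MonoidHom.comp_apply, MonoidHom.prodMap_def, MonoidHom.prod_apply,
      MonoidHom.coe_fst, MonoidHom.coe_snd, Subgroup.coe_subtype, braidJuxt,
      MonoidHom.noncommCoprod_apply, map_mul, Equiv.Perm.mul_apply]
    obtain ⟨k, hk⟩ := k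
    by_cases h : k < m * ∑ i, ξ i
    · rw [(braidPerm_shift _ _ _ _ y.1).2 ⟨k, hk⟩ (Or.inl h)]
      obtain ⟨j, rfl⟩ : ∃ j : Fin (m * ∑ i, ξ i), k = 0 + j := ⟨⟨k, h⟩, by simp⟩
      rw [(braidPerm_shift _ _ _ _ x.1).1 j,
        strandColor_concat_left ξ m n (braidPerm _ x.1 j) _ (by simp), x.2 j,
        strandColor_concat_left ξ m n j _ (by simp)]
    · obtain ⟨j, rfl⟩ : ∃ j : Fin (n * ∑ i, ξ i), k = m * ∑ i, ξ i + j :=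
        ⟨⟨k - m * ∑ i, ξ i, by omega⟩, by simp only; omega⟩
      rw [(braidPerm_shift _ _ _ _ y.1).1 j,
        (braidPerm_shift _ _ _ _ x.1).2 _ (Or.inr (by simp only; omega)),
        strandColor_concat_right ξ m n (braidPerm _ y.1 j) _ (by simp), y.2 j,
        strandColor_concat_right ξ m n j _ (by simp)])

/-- Concatenation of Hurwitz vectors. -/
def HurwitzVector.concat {c : Fin t → ConjClasses G} {ξ : Fin t → ℕ} {m n : ℕ}
    (g : HurwitzVector c ξ m) (h : HurwitzVector c ξ n) : HurwitzVector c ξ (m + n) :=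
  ⟨HurwitzSpace.concat (Nat.add_mul m n (∑ i, ξ i)).symm g.1 h.1, fun j => by
    have hmn := Nat.add_mul m n (∑ i, ξ i)
    have hj := j.2
    rw [HurwitzSpace.concat]
    split_ifs with hlt
    · rw [g.2, strandColor_concat_left ξ m n ⟨j, hlt⟩ j rfl]
    · rw [h.2, strandColor_concat_right ξ m n ⟨j - m * ∑ i, ξ i, by omega⟩ j
        (by simp only; omega)]⟩

theorem HurwitzVector.concat_smul {c : Fin t → ConjClasses G} {ξ : Fin t → ℕ} {m n : ℕ}
    (b : ColBraid ξ m × ColBraid ξ n) (g : HurwitzVector c ξ m) (h : HurwitzVector c ξ n) :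
    (b.1 • g).concat (b.2 • h) = colBraidJuxt ξ m n b • g.concat h :=
  Subtype.ext (hurwitzAction_concat (Nat.add_mul m n (∑ i, ξ i)).symm (b.1.1, b.2.1) g.1 h.1).symm

/-- The multiplication `Hur_{m·ξ} × Hur_{n·ξ} → Hur_{(m+n)·ξ}` induced by juxtaposition of braids
and concatenation of Hurwitz vectors. -/
noncomputable def Hur.mul {c : Fin t → ConjClasses G} {ξ : Fin t → ℕ} {m n : ℕ}
    (z : Hur c ξ m × Hur c ξ n) : Hur c ξ (m + n) :=
  Quotient.map₂ (fun x y => (milnorMul (colBraidJuxt ξ m n) (x.1, y.1), x.2.concat y.2)) (by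
    rintro _ x ⟨a, rfl⟩ _ y ⟨b, rfl⟩
    exact ⟨colBraidJuxt ξ m n (a, b), Prod.ext
      (milnorMul_smul (colBraidJuxt ξ m n) (a, b) x.1 y.1).symm
      (HurwitzVector.concat_smul (a, b) x.2 y.2).symm⟩) z.1 z.2

theorem Hur.continuous_mul {c : Fin t → ConjClasses G} {ξ : Fin t → ℕ} {m n : ℕ} :
    Continuous (Hur.mul : Hur c ξ m × Hur c ξ n → Hur c ξ (m + n)) := by
  refine (Hur.isOpenQuotientMap_mk.prodMap
    Hur.isOpenQuotientMap_mk).isQuotientMap.continuous_iff.2 ?_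
  refine Hur.isOpenQuotientMap_mk.continuous.comp (Continuous.prodMk ?_ ?_)
  · exact (continuous_milnorMul _).comp
      ((continuous_fst.comp continuous_fst).prodMk (continuous_fst.comp continuous_snd))
  · exact (continuous_of_discreteTopology
      (f := fun p : HurwitzVector c ξ m × HurwitzVector c ξ n => p.1.concat p.2)).comp
      ((continuous_snd.comp continuous_fst).prodMk (continuous_snd.comp continuous_snd))

end Spaces

/-! ### Homology -/

section Homology

variable (A : Type u) [CommRing A]

/-- Singular homology `H_p(X; A)`. -/
noncomputable abbrev SingHomology (p : ℕ) (X : Type u) [TopologicalSpace X] : ModuleCat.{u} A :=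
  ((singularHomologyFunctor (ModuleCat.{u} A) p).obj (ModuleCat.of A A)).obj (TopCat.of X)

/-- The map induced on singular homology by a continuous map. -/
noncomputable def Hmap (p : ℕ) {X Y : Type u} [TopologicalSpace X] [TopologicalSpace Y]
    (f : C(X, Y)) : SingHomology A p X →ₗ[A] SingHomology A p Y :=
  (((singularHomologyFunctor (ModuleCat.{u} A) p).obj (ModuleCat.of A A)).map
    (TopCat.ofHom f)).hom

theorem Hmap_eq_of_homotopy (p : ℕ) {X Y : Type u} [TopologicalSpace X] [TopologicalSpace Y]
    {f g : C(X, Y)} (h : f.Homotopy g) : Hmap A p f = Hmap A p g :=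
  congrArg ModuleCat.Hom.hom
    (TopCat.Homotopy.congr_homologyMap_singularChainComplexFunctor
      (f := TopCat.ofHom f) (g := TopCat.ofHom g) h (ModuleCat.of A A) p)

/-- The inclusion `Y → X × Y`, `y ↦ (x, y)`. -/
def slice {X Y : Type u} [TopologicalSpace X] [TopologicalSpace Y] (x : X) : C(Y, X × Y) :=
  ⟨fun y => (x, y), by fun_prop⟩

/-- A path from `x` to `x'` gives a homotopy between the corresponding slice inclusions. -/
def sliceHomotopy {X Y : Type u} [TopologicalSpace X] [TopologicalSpace Y] {x x' : X}
    (γ : Path x x') : (slice (Y := Y) x).Homotopy (slice x') where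
  toFun z := (γ z.1, z.2)
  continuous_toFun := by fun_prop
  map_zero_left y := by simp [slice]
  map_one_left y := by simp [slice]

/-- The homology cross product `H_0(X; A) → Hom_A(H_p(Y; A), H_p(X × Y; A))`. As `H_0(X; A)` is free
on the path components of `X`, it is determined by its values on the classes of points `x`, which act
by the map that the inclusion `y ↦ (x, y)` induces. -/
noncomputable def crossZero (p : ℕ) (X Y : Type u) [TopologicalSpace X] [TopologicalSpace Y] :
    SingHomology A 0 X →ₗ[A] SingHomology A p Y →ₗ[A] SingHomology A p (X × Y) :=
  (Limits.Sigma.desc (P := ModuleCat.of A (SingHomology A p Y →ₗ[A] SingHomology A p (X × Y)))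
    (f := fun _ : ZerothHomotopy X => ModuleCat.of A A)
    (fun s => ModuleCat.ofHom (LinearMap.toSpanSingleton A _
      (ZerothHomotopy.lift (fun x => Hmap A p (slice x))
        (fun _ _ γ => Hmap_eq_of_homotopy A p (sliceHomotopy γ)) s)))).hom.comp
    (TopCat.singularHomology₀Iso (TopCat.of X) (ModuleCat.of A A)).hom.hom

variable {G : Type u} [Group G] {t : ℕ}

/-- The homogeneous part of degree `d` of the ring of connected components
`R = ⨁_d H_0(Hur_{d·ξ}; A)`. -/
noncomputable abbrev componentRingDeg (c : Fin t → ConjClasses G) (ξ : Fin t → ℕ) (d : ℕ) : ModuleCat.{u} A :=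
  SingHomology A 0 (Hur c ξ d)

/-- Conjugation by `g` as a self-map of the marked Hurwitz space. -/
noncomputable def conjMap (c : Fin t → ConjClasses G) (ξ : Fin t → ℕ) (n : ℕ) (g : G) :
    C(Hur c ξ n, Hur c ξ n) :=
  ⟨fun x => g • x, continuous_const_smul g⟩

/-- Left multiplication by `U ∈ R_d` on `M_p = ⨁_n H_p(Hur_{n·ξ}; A)`, in source degree `n`: the
cross product with `U` followed by the map induced by `Hur_{d·ξ} × Hur_{n·ξ} → Hur_{(d+n)·ξ}`. -/
noncomputable def mulLeft {c : Fin t → ConjClasses G} {ξ : Fin t → ℕ} {d : ℕ} (U : componentRingDeg A c ξ d)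
    (p n : ℕ) : SingHomology A p (Hur c ξ n) →ₗ[A] SingHomology A p (Hur c ξ (d + n)) :=
  (Hmap A p ⟨Hur.mul, Hur.continuous_mul⟩).comp (crossZero A p (Hur c ξ d) (Hur c ξ n) U)

end Homology

end HurwitzSpace

/-! Since |G| is invertible in A, the homology of Hur/G is controlled by the G-action on the
homology of Hur, and multiplication by U respects that action. The link is a transfer. Let π be the
map on homology from marked to unmarked covers. There is a map τ back with πτ = |G| and τπ = ∑ g. If
φ is multiplication by U, then φ commutes with every g, hence with τπ. So π'φτ is an isomorphism: up
to the unit |G|², π inverts it after pulling back along φ (`nonempty_equiv_of_transfer`).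

On chains, τ sends a simplex of the quotient to the sum over g in G of the translates of a lift.
This needs every singular simplex of Hur/G to lift to Hur, and any two lifts to differ by an element
of G. The action of G need not be free, so Hur is not treated as a principal G-cover. Instead, with
V the set of Hurwitz vectors, Hur/G is the Borel construction on V/G, and both E × V → Hur and E ×
V/G → Hur/G are coverings with the coloured braid group as deck group
(`UnmarkedHur.isQuotientCoveringMap_mk`). A simplex lifts through them, and its discrete coordinate
is constant. This gives `Hur.exists_unmark_comp_eq` and `Hur.exists_smul_eq_of_unmark_comp_eq`.

That φ commutes with G (`mulLeft_conj`) follows from the invariance of U, the naturality of the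
cross product and the G-equivariance of concatenation. -/

namespace HurwitzSpace

open CategoryTheory AlgebraicTopology Limits Simplicial

/-! ### Transfer on simplicial chains -/

section Transfer

variable {C : Type*} [Category C] [HasCoproducts.{u} C] [Preadditive C] (R : C)
  {X Y : SSet.{u}} {G : Type*} [Group G] [Fintype G]

/-- The map out of the simplicial chains determined by its values on simplices. -/
noncomputable def chainDesc {R T : C} {n : ℕ} (f : Y _⦋n⦌ → (R ⟶ T)) :
    (Y.chainComplex R).X n ⟶ T :=
  Cofan.IsColimit.desc (Y.isColimitChainComplexXCofan R n) f

theorem ι_chainDesc {R T : C} {n : ℕ} (f : Y _⦋n⦌ → (R ⟶ T)) (y : Y _⦋n⦌) :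
    Y.ιChainComplex y ≫ chainDesc f = f y :=
  Cofan.IsColimit.fac (Y.isColimitChainComplexXCofan R n) f y

theorem ι_chainDesc_assoc {R T Z : C} {n : ℕ} (f : Y _⦋n⦌ → (R ⟶ T)) (y : Y _⦋n⦌) (h : T ⟶ Z) :
    Y.ιChainComplex y ≫ chainDesc f ≫ h = f y ≫ h := by
  rw [← Category.assoc, ι_chainDesc]

/-- The sum of the translates of a simplex, as a chain. -/
noncomputable def orbitSum (a : G → (X ⟶ X)) {n : ℕ} (x : X _⦋n⦌) :
    R ⟶ (X.chainComplex R).X n :=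
  ∑ g, X.ιChainComplex ((a g).app _ x)

theorem orbitSum_smul {a : G → (X ⟶ X)} (ha : ∀ g h, a (g * h) = a h ≫ a g) {n : ℕ}
    (x : X _⦋n⦌) (h : G) : orbitSum R a ((a h).app _ x) = orbitSum R a x := by
  refine Fintype.sum_equiv (Equiv.mulRight h) _ _ fun g => ?_
  rw [Equiv.coe_mulRight, ha]
  rfl

-- Each translation is simplicial, so it commutes with faces, and the sums over G and over faces can
-- be exchanged.
omit [Group G] in
theorem orbitSum_d (a : G → (X ⟶ X)) {n : ℕ} (x : X _⦋n + 1⦌) :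
    orbitSum R a x ≫ (X.chainComplex R).d (n + 1) n =
      ∑ i : Fin (n + 2), (-1) ^ i.val • orbitSum R a (X.δ i x) := by
  simp only [orbitSum, Preadditive.sum_comp, SSet.ιChainComplex_d, Finset.smul_sum]
  rw [Finset.sum_comm]
  refine Finset.sum_congr rfl fun i _ => Finset.sum_congr rfl fun g _ => ?_
  rw [SSet.δ_naturality_apply]

variable {a : G → (X ⟶ X)} (ha : ∀ g h, a (g * h) = a h ≫ a g) {p : X ⟶ Y}
    (hs : ∀ (n : ℕ) (y : Y _⦋n⦌), ∃ x, p.app _ x = y)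
    (hf : ∀ (n : ℕ) (x x' : X _⦋n⦌), p.app _ x = p.app _ x' → ∃ g, (a g).app _ x' = x)

-- Simplices with the same image are translates of each other, and translating only reindexes the
-- sum. The orbit sum thus depends on the image alone, which makes the transfer independent of
-- chosen lifts.
include ha hf in
theorem orbitSum_eq {n : ℕ} {x x' : X _⦋n⦌} (h : p.app _ x = p.app _ x') :
    orbitSum R a x = orbitSum R a x' := by
  obtain ⟨g, rfl⟩ := hf n x x' h
  exact orbitSum_smul R ha x' g

/-- The transfer of a map of simplicial sets whose fibres are the orbits of a finite group. -/
noncomputable def transfer : Y.chainComplex R ⟶ X.chainComplex R where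
  f n := chainDesc fun y => orbitSum R a (hs n y).choose
  comm' := by
    rintro _ n rfl
    ext y
    rw [ι_chainDesc_assoc, orbitSum_d, SSet.ιChainComplex_d_assoc, Preadditive.sum_comp]
    refine Finset.sum_congr rfl fun i _ => ?_
    rw [Preadditive.zsmul_comp, ι_chainDesc]
    congr 1
    -- A face of the chosen lift and the chosen lift of that face may differ, but they lie over the
    -- same simplex.
    refine orbitSum_eq R ha hf ?_
    rw [(hs _ _).choose_spec, SSet.δ_naturality_apply, (hs _ _).choose_spec]

theorem ι_transfer {n : ℕ} (x : X _⦋n⦌) :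
    Y.ιChainComplex (p.app _ x) ≫ (transfer R ha hs hf).f n = orbitSum R a x :=
  (ι_chainDesc _ _).trans (orbitSum_eq R ha hf (hs _ _).choose_spec)

theorem chainComplexMap_transfer :
    SSet.chainComplexMap p R ≫ transfer R ha hs hf = ∑ g, SSet.chainComplexMap (a g) R := by
  ext n x
  rw [HomologicalComplex.comp_f, SSet.ι_chainComplexMap_f_assoc, ι_transfer, orbitSum]
  rw [show (∑ g, SSet.chainComplexMap (a g) R).f n = ∑ g, (SSet.chainComplexMap (a g) R).f n from
    map_sum (HomologicalComplex.Hom.fAddMonoidHom n) _ _, Preadditive.comp_sum]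
  simp

/-- All translates of a lift have the same image. The orbit sum runs over G, not over the orbit, so
the factor is |G| even when simplices have stabilisers. -/
theorem transfer_chainComplexMap (hp : ∀ g, a g ≫ p = p) :
    transfer R ha hs hf ≫ SSet.chainComplexMap p R = Fintype.card G • 𝟙 _ := by
  ext n y
  obtain ⟨x, rfl⟩ := hs n y
  rw [HomologicalComplex.comp_f, ← Category.assoc, ι_transfer, orbitSum, Preadditive.sum_comp]
  have : ∀ g, p.app _ ((a g).app _ x) = p.app _ x := fun g =>
    congrArg (fun q : X ⟶ Y => q.app _ x) (hp g)
  simp [this]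

end Transfer
-- Transfer on singular homology
section Transfer

variable (A : Type u) [CommRing A] {X Y : Type u} [TopologicalSpace X] [TopologicalSpace Y]
  {G : Type*} [Group G] [Fintype G]

/-- If a finite group `G` acts on `X` and the singular simplices of `Y` are the `G`-orbits of those
of `X`, then homology has a transfer from `Y` to `X`. -/
theorem exists_homology_transfer (a : G → C(X, X)) (ha : ∀ g h, a (g * h) = (a g).comp (a h))
    (p : C(X, Y)) (hp : ∀ g, p.comp (a g) = p)
    (hs : ∀ (n : ℕ) (y : C(stdSimplex ℝ (Fin (n + 1)), Y)), ∃ x, p.comp x = y)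
    (hf : ∀ (n : ℕ) (x x' : C(stdSimplex ℝ (Fin (n + 1)), X)), p.comp x = p.comp x' →
      ∃ g, (a g).comp x' = x) (k : ℕ) :
    ∃ τ : SingHomology A k Y →ₗ[A] SingHomology A k X,
      (∀ y, Hmap A k p (τ y) = Fintype.card G • y) ∧
        ∀ x, τ (Hmap A k p x) = ∑ g, Hmap A k (a g) x := by
  let b : G → (TopCat.toSSet.obj (TopCat.of X) ⟶ TopCat.toSSet.obj (TopCat.of X)) :=
    fun g => TopCat.toSSet.map (TopCat.ofHom (a g))
  let q : TopCat.toSSet.obj (TopCat.of X) ⟶ TopCat.toSSet.obj (TopCat.of Y) :=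
    TopCat.toSSet.map (TopCat.ofHom p)
  have hb : ∀ g h, b (g * h) = b h ≫ b g := fun g h => by
    simp only [b, ha, ← Functor.map_comp, ← TopCat.ofHom_comp]
  have hq : ∀ g, b g ≫ q = q := fun g => by
    simp only [b, q, ← Functor.map_comp, ← TopCat.ofHom_comp, hp]
  -- Simplices of the singular set are continuous maps and the induced maps are postcomposition, so
  -- the conditions `hs` and `hf` carry over to simplicial sets.
  have hbq : ∀ (n : ℕ) (x : (TopCat.toSSet.obj (TopCat.of X)) _⦋n⦌),
    TopCat.toSSetObjEquiv _ _ (q.app _ x) = p.comp (TopCat.toSSetObjEquiv _ _ x) := fun _ _ => rfl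
  have hbb : ∀ (n : ℕ) (g : G) (x : (TopCat.toSSet.obj (TopCat.of X)) _⦋n⦌),
    TopCat.toSSetObjEquiv _ _ ((b g).app _ x) = (a g).comp (TopCat.toSSetObjEquiv _ _ x) :=
      fun _ _ _ => rfl
  have hs' : ∀ (n : ℕ) (y : (TopCat.toSSet.obj (TopCat.of Y)) _⦋n⦌), ∃ x, q.app _ x = y := by
    intro n y
    obtain ⟨x, hx⟩ := hs n (TopCat.toSSetObjEquiv _ _ y)
    refine ⟨(TopCat.toSSetObjEquiv _ _).symm x, (TopCat.toSSetObjEquiv _ _).injective ?_⟩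
    rw [hbq, Equiv.apply_symm_apply, hx]
  have hf' : ∀ (n : ℕ) (x x' : (TopCat.toSSet.obj (TopCat.of X)) _⦋n⦌),
      q.app _ x = q.app _ x' → ∃ g, (b g).app _ x' = x := by
    intro n x x' h
    obtain ⟨g, hg⟩ := hf n (TopCat.toSSetObjEquiv _ _ x) (TopCat.toSSetObjEquiv _ _ x') (by
      rw [← hbq, ← hbq, h])
    exact ⟨g, (TopCat.toSSetObjEquiv _ _).injective ((hbb _ _ _).trans hg)⟩
  let T := transfer (ModuleCat.of A A) hb hs' hf'
  refine ⟨(HomologicalComplex.homologyMap T k).hom, fun y => ?_, fun x => ?_⟩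
  · have := congrArg (fun f => HomologicalComplex.homologyMap f k)
      (transfer_chainComplexMap (ModuleCat.of A A) hb hs' hf' hq)
    simp only [HomologicalComplex.homologyMap_comp] at this
    have h2 : HomologicalComplex.homologyMap
      (Fintype.card G • 𝟙 ((TopCat.toSSet.obj (TopCat.of Y)).chainComplex (ModuleCat.of A A))) k =
        Fintype.card G • 𝟙 _ := by
      rw [← HomologicalComplex.homologyMap_id]
      exact map_nsmul (HomologicalComplex.homologyFunctor _ _ k).mapAddHom _ _
    rw [h2] at this
    exact congrArg (fun f => f.hom y) this
  · have := congrArg (fun f => HomologicalComplex.homologyMap f k)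
      (chainComplexMap_transfer (ModuleCat.of A A) hb hs' hf')
    simp only [HomologicalComplex.homologyMap_comp] at this
    have h2 : HomologicalComplex.homologyMap
      (∑ g, SSet.chainComplexMap (b g) (ModuleCat.of A A)) k =
        ∑ g, HomologicalComplex.homologyMap (SSet.chainComplexMap (b g) (ModuleCat.of A A)) k :=
      map_sum (HomologicalComplex.homologyFunctor _ _ k).mapAddHom _ _
    rw [h2] at this
    have h3 : ∀ {M N : ModuleCat.{u} A} (f : G → (M ⟶ N)) (z : M),
        (∑ g, f g).hom z = ∑ g, (f g).hom z := fun f z => by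
      rw [ModuleCat.hom_sum, LinearMap.sum_apply]
    exact (congrArg (fun f => f.hom x) this).trans (h3 _ x)

end Transfer

end HurwitzSpace

namespace HurwitzSpace

/-! ### Coverings by the coloured braid group and lifting of simplices -/

section Lifting

/-- Every point of the infinite join has a neighbourhood that is disjoint from its translates. -/
theorem MilnorE.exists_nhds_disjoint {Γ : Type} [Group Γ] (x : MilnorE Γ) :
    ∃ U ∈ nhds x, ∀ g : Γ, ∀ y ∈ U, g • y ∈ U → g = 1 := by
  classical
  obtain ⟨⟨i, γ⟩, h⟩ : ∃ a, x.1.weights a ≠ 0 := by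
    by_contra! h
    have := x.1.total
    rw [show x.1.weights = 0 from Finsupp.ext h] at this
    simp at this
  -- If y and g • y both have weight at (i, γ), then y has weight at (i, γ) and at (i, g⁻¹γ). A
  -- point of the join has at most one group element at each index i, so g = 1.
  refine ⟨{y | y.1.weights (i, γ) ≠ 0}, ?_, fun g y hy hgy => ?_⟩
  · exact (isOpen_ne_fun ((continuous_weight _).comp continuous_subtype_val)
      continuous_const).mem_nhds h
  · obtain ⟨⟨j, b⟩, hb, hb'⟩ := exists_of_map_ne_zero _ _ _ hgy
    obtain ⟨rfl, rfl⟩ := Prod.mk.inj hb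
    simpa using y.2 _ _ _ hb' hy

variable {G : Type u} [Group G] {t : ℕ} (c : Fin t → ConjClasses G) (ξ : Fin t → ℕ) (n : ℕ)

/-- Hurwitz vectors up to simultaneous conjugation, a discrete space. -/
abbrev HurwitzVectorClass : Type u := MulAction.orbitRel.Quotient G (HurwitzVector c ξ n)

instance : TopologicalSpace (HurwitzVectorClass c ξ n) := ⊥

instance : DiscreteTopology (HurwitzVectorClass c ξ n) := ⟨rfl⟩

instance : MulAction (ColBraid ξ n) (HurwitzVectorClass c ξ n) where
  smul b := Quotient.map (fun v => b • v) (by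
    rintro _ v ⟨x, rfl⟩
    exact ⟨x, (braid_smul_conj_smul b x v).symm⟩)
  one_smul := by
    rintro ⟨v⟩
    exact congrArg (Quotient.mk _) (one_smul _ v)
  mul_smul a b := by
    rintro ⟨v⟩
    exact congrArg (Quotient.mk _) (mul_smul a b v)

instance : ContinuousConstSMul (ColBraid ξ n) (HurwitzVectorClass c ξ n) where
  continuous_const_smul _ := continuous_of_discreteTopology

variable {c ξ n}

/-- The quotient map from marked to unmarked Hurwitz spaces. -/
noncomputable def Hur.unmark : C(Hur c ξ n, UnmarkedHur c ξ n) :=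
  ⟨Quotient.mk (MulAction.orbitRel G (Hur c ξ n)), continuous_quotient_mk'⟩

theorem Hur.unmark_eq_iff {z w : Hur c ξ n} : Hur.unmark z = Hur.unmark w ↔ ∃ g : G, g • w = z :=
  Quotient.eq

theorem Hur.mk_eq_iff {z w : MilnorE (ColBraid ξ n) × HurwitzVector c ξ n} :
    (Hur.mk z = Hur.mk w) ↔ ∃ b : ColBraid ξ n, b • w = z :=
  Quotient.eq

/-- The class of a point of `E × V/G` in the unmarked Hurwitz space. -/
noncomputable def UnmarkedHur.mk (z : MilnorE (ColBraid ξ n) × HurwitzVectorClass c ξ n) :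
    UnmarkedHur c ξ n :=
  Quotient.lift (fun v => Hur.unmark (Hur.mk (z.1, v))) (by
    rintro _ v ⟨g, rfl⟩
    exact Hur.unmark_eq_iff.2 ⟨g, rfl⟩) z.2

theorem UnmarkedHur.mk_mk (e : MilnorE (ColBraid ξ n)) (v : HurwitzVector c ξ n) :
    UnmarkedHur.mk (e, (Quotient.mk _ v : HurwitzVectorClass c ξ n)) = Hur.unmark (Hur.mk (e, v)) :=
  rfl

/-- The braid action is already free and properly discontinuous on the factor E, so neighbourhoods
pulled back from E suffice. -/
theorem Hur.isQuotientCoveringMap_mk :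
    IsQuotientCoveringMap (Hur.mk (c := c) (ξ := ξ) (n := n)) (ColBraid ξ n) where
  toIsQuotientMap := Hur.isOpenQuotientMap_mk.isQuotientMap
  continuous_const_smul := fun b => continuous_const_smul b
  apply_eq_iff_mem_orbit := Hur.mk_eq_iff
  disjoint := by
    rintro ⟨e, v⟩
    obtain ⟨U, hU, h⟩ := MilnorE.exists_nhds_disjoint e
    refine ⟨Prod.fst ⁻¹' U, continuous_fst.continuousAt hU, ?_⟩
    rintro b ⟨_, ⟨z, hz, rfl⟩, hz'⟩
    exact h b z.1 hz hz'

/-- The braid action and conjugation commute and G does not touch E, so dividing E × V by braids and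
then by G is the same as dividing E × V/G by braids. Fixed vectors of G cause no trouble, because
freeness again comes from E. -/
theorem UnmarkedHur.isQuotientCoveringMap_mk :
    IsQuotientCoveringMap (UnmarkedHur.mk (c := c) (ξ := ξ) (n := n)) (ColBraid ξ n) := by
  have hcont : Continuous (UnmarkedHur.mk (c := c) (ξ := ξ) (n := n)) := by
    rw [continuous_prod_of_discrete_right]
    rintro ⟨v⟩
    exact Hur.unmark.continuous.comp (Hur.isOpenQuotientMap_mk.continuous.comp
      (Continuous.prodMk_left v))
  -- This composite is by definition E × V → Hur → Hur/G, a composite of quotient maps. Its second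
  -- factor is then a quotient map as well.
  have hq : Topology.IsQuotientMap (UnmarkedHur.mk (c := c) (ξ := ξ) (n := n) ∘
      Prod.map id (Quotient.mk (MulAction.orbitRel G (HurwitzVector c ξ n)))) :=
    (MulAction.isOpenQuotientMap_quotientMk (Γ := G) (T := Hur c ξ n)).isQuotientMap.comp
      Hur.isOpenQuotientMap_mk.isQuotientMap
  refine { Topology.IsQuotientMap.of_comp (continuous_id.prodMap continuous_of_discreteTopology)
      hcont hq with
    continuous_const_smul := fun b => continuous_const_smul b
    apply_eq_iff_mem_orbit := ?_
    disjoint := ?_ }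
  · rintro ⟨e, ⟨v⟩⟩ ⟨e', ⟨v'⟩⟩
    constructor
    · intro h
      obtain ⟨g, hg⟩ := Hur.unmark_eq_iff.1 h
      obtain ⟨b, hb⟩ := Hur.mk_eq_iff.1 ((Hur.smul_mk g (e', v')).symm.trans hg)
      obtain ⟨h1, h2⟩ := Prod.mk.inj hb
      refine ⟨b⁻¹, inv_smul_eq_iff.2 (Prod.ext h1.symm ?_)⟩
      exact (Quotient.sound ⟨g, h2.symm⟩ :
        (Quotient.mk (MulAction.orbitRel G (HurwitzVector c ξ n)) (b • v)) = Quotient.mk _ v').symm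
    · rintro ⟨b, hb⟩
      obtain ⟨h1, h2⟩ := Prod.mk.inj hb
      obtain ⟨g, hg⟩ := Quotient.exact h2
      refine Hur.unmark_eq_iff.2 ⟨g⁻¹, inv_smul_eq_iff.2 ?_⟩
      rw [Hur.smul_mk]
      exact (Hur.mk_eq_iff (z := (e, g • v)) (w := (e', v'))).2 ⟨b, Prod.ext h1 hg.symm⟩ |>.symm
  · rintro ⟨e, v⟩
    obtain ⟨U, hU, h⟩ := MilnorE.exists_nhds_disjoint e
    refine ⟨Prod.fst ⁻¹' U, continuous_fst.continuousAt hU, ?_⟩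
    rintro b ⟨_, ⟨z, hz, rfl⟩, hz'⟩
    exact h b z.1 hz hz'

/-! ### Lifting maps from a simply connected, locally path connected space -/

section

variable {Δ : Type*} [TopologicalSpace Δ] [SimplyConnectedSpace Δ] [LocallyPathConnectedSpace Δ]

/-- Lift through the covering E × V → Hur. The V-coordinate is a continuous map from a connected
space to a discrete one, hence constant. -/
theorem Hur.exists_lift (x : C(Δ, Hur c ξ n)) :
    ∃ (e : C(Δ, MilnorE (ColBraid ξ n))) (v : HurwitzVector c ξ n), ∀ a, x a = Hur.mk (e a, v) := by
  obtain ⟨a₀⟩ : Nonempty Δ := inferInstance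
  obtain ⟨z₀, hz₀⟩ := Hur.isOpenQuotientMap_mk.surjective (x a₀)
  obtain ⟨F, ⟨-, hF⟩, -⟩ :=
    Hur.isQuotientCoveringMap_mk.isCoveringMap.existsUnique_continuousMap_lifts x a₀ z₀ hz₀
  refine ⟨⟨fun a => (F a).1, by fun_prop⟩, (F a₀).2, fun a => ?_⟩
  have : (F a₀).2 = (F a).2 :=
    PreconnectedSpace.constant inferInstance (f := fun a => (F a).2) (by fun_prop)
  rw [this]
  exact (congrFun hF a).symm

/-- After lifting to E × V/G the class in V/G is constant, so one representative vector serves all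
of Δ. -/
theorem Hur.exists_unmark_comp_eq (y : C(Δ, UnmarkedHur c ξ n)) :
    ∃ x : C(Δ, Hur c ξ n), Hur.unmark.comp x = y := by
  obtain ⟨a₀⟩ : Nonempty Δ := inferInstance
  obtain ⟨z₀, hz₀⟩ := UnmarkedHur.isQuotientCoveringMap_mk.surjective (y a₀)
  obtain ⟨F, ⟨-, hF⟩, -⟩ :=
    UnmarkedHur.isQuotientCoveringMap_mk.isCoveringMap.existsUnique_continuousMap_lifts y a₀ z₀ hz₀
  obtain ⟨v, hv⟩ := Quotient.exists_rep (F a₀).2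
  refine ⟨⟨fun a => Hur.mk ((F a).1, v),
    Hur.isOpenQuotientMap_mk.continuous.comp (by fun_prop)⟩, ContinuousMap.ext fun a => ?_⟩
  have : (F a₀).2 = (F a).2 :=
    PreconnectedSpace.constant inferInstance (f := fun a => (F a).2) (by fun_prop)
  rw [← hF, Function.comp_apply, ← Prod.mk.eta (p := F a), ← this, ← hv]
  rfl

/-- Pointwise the two maps differ by elements of G that could vary. Uniqueness of lifts to E × V/G
makes a single braid b, and with it a single g, work everywhere. -/
theorem Hur.exists_smul_eq_of_unmark_comp_eq {x x' : C(Δ, Hur c ξ n)}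
    (h : Hur.unmark.comp x = Hur.unmark.comp x') : ∃ g : G, ∀ a, g • x' a = x a := by
  obtain ⟨e, v, hx⟩ := Hur.exists_lift x
  obtain ⟨e', v', hx'⟩ := Hur.exists_lift x'
  obtain ⟨a₀⟩ : Nonempty Δ := inferInstance
  have hxx' : ∀ a, UnmarkedHur.mk (e a, (Quotient.mk _ v : HurwitzVectorClass c ξ n)) =
      UnmarkedHur.mk (e' a, (Quotient.mk _ v' : HurwitzVectorClass c ξ n)) := fun a => by
    rw [UnmarkedHur.mk_mk, UnmarkedHur.mk_mk, ← hx, ← hx']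
    exact congrArg (fun f => f a) h
  obtain ⟨b, hb⟩ := UnmarkedHur.isQuotientCoveringMap_mk.apply_eq_iff_mem_orbit.1 (hxx' a₀)
  have hF := UnmarkedHur.isQuotientCoveringMap_mk.isCoveringMap.eq_of_comp_eq
    (g₁ := fun a => b • (e' a, (Quotient.mk _ v' : HurwitzVectorClass c ξ n)))
    (g₂ := fun a => (e a, (Quotient.mk _ v : HurwitzVectorClass c ξ n)))
    ((continuous_const_smul b).comp (by fun_prop)) (by fun_prop) (funext fun a =>
      (UnmarkedHur.isQuotientCoveringMap_mk.map_smul b).trans (hxx' a).symm) a₀ hb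
  -- Equality of classes gives g • v = b • v', so x' = g • x on all of Δ and the required element is
  -- g⁻¹.
  obtain ⟨g, hg⟩ := Quotient.exact (Prod.mk.inj hb).2
  refine ⟨g⁻¹, fun a => inv_smul_eq_iff.2 ?_⟩
  rw [hx, hx', Hur.smul_mk]
  exact (Hur.mk_eq_iff.2 ⟨b, Prod.ext (Prod.mk.inj (congrFun hF a)).1 hg.symm⟩).symm

end

instance stdSimplex_simplyConnectedSpace (k : ℕ) :
    SimplyConnectedSpace (stdSimplex ℝ (Fin (k + 1))) := by
  have := (convex_stdSimplex ℝ (Fin (k + 1))).contractibleSpace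
    (Set.nonempty_coe_sort.1 inferInstance)
  infer_instance

instance stdSimplex_locallyPathConnectedSpace (k : ℕ) :
    LocallyPathConnectedSpace (stdSimplex ℝ (Fin (k + 1))) :=
  (convex_stdSimplex ℝ (Fin (k + 1))).locallyPathConnectedSpace

theorem exists_unmark_transfer [Fintype G] (A : Type u) [CommRing A] (k : ℕ) :
    ∃ τ : SingHomology A k (UnmarkedHur c ξ n) →ₗ[A] SingHomology A k (Hur c ξ n),
      (∀ y, Hmap A k Hur.unmark (τ y) = Fintype.card G • y) ∧
        ∀ x, τ (Hmap A k Hur.unmark x) = ∑ g, Hmap A k (conjMap c ξ n g) x :=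
  exists_homology_transfer A (conjMap c ξ n)
    (fun g h => ContinuousMap.ext fun z => mul_smul g h z) Hur.unmark
    (fun g => ContinuousMap.ext fun _ => Hur.unmark_eq_iff.2 ⟨g, rfl⟩)
    (fun _ y => Hur.exists_unmark_comp_eq y)
    (fun _ _ _ h => (Hur.exists_smul_eq_of_unmark_comp_eq h).imp fun _ hg =>
      ContinuousMap.ext hg) k

end Lifting
end HurwitzSpace

namespace HurwitzSpace

open CategoryTheory AlgebraicTopology Limits Simplicial

/-! ### Degree-zero classes, the cross product and equivariance of multiplication -/

section Cross

variable (A : Type u) [CommRing A]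

theorem Hmap_comp_apply (p : ℕ) {X Y Z : Type u} [TopologicalSpace X] [TopologicalSpace Y]
    [TopologicalSpace Z] (g : C(Y, Z)) (f : C(X, Y)) (x : SingHomology A p X) :
    Hmap A p (g.comp f) x = Hmap A p g (Hmap A p f x) := by
  simp only [Hmap]
  rw [TopCat.ofHom_comp, Functor.map_comp]
  rfl

/-- The class of a vertex in simplicial homology of degree `0`. -/
noncomputable def vertexClass (S : SSet.{u}) (R : ModuleCat.{u} A) (x : S _⦋0⦌) :
    R ⟶ S.homology R 0 :=
  (S.chainComplex R).liftCycles (S.ιChainComplex x) 0 (by simp) (by simp) ≫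
    (S.chainComplex R).homologyπ 0

theorem vertexClass_homologyMap {S T : SSet.{u}} (R : ModuleCat.{u} A) (f : S ⟶ T) (x : S _⦋0⦌) :
    vertexClass A S R x ≫ SSet.homologyMap f R 0 = vertexClass A T R (f.app _ x) := by
  rw [vertexClass, Category.assoc, HomologicalComplex.homologyπ_naturality,
    HomologicalComplex.liftCycles_comp_cyclesMap_assoc, vertexClass]
  simp only [SSet.ι_chainComplexMap_f]

/-- The class of a point in singular homology of degree `0`. -/
noncomputable def pointClass {X : Type u} [TopologicalSpace X] (x : X) :
    ModuleCat.of A A ⟶ SingHomology A 0 X :=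
  vertexClass A (TopCat.toSSet.obj (TopCat.of X)) (ModuleCat.of A A)
    (TopCat.toSSetObj₀Equiv (X := TopCat.of X).symm x)

theorem pointClass_singularHomology₀Iso {X : Type u} [TopologicalSpace X] (x : X) :
    pointClass A x ≫ (TopCat.singularHomology₀Iso (TopCat.of X) (ModuleCat.of A A)).hom =
      Sigma.ι (fun _ : ZerothHomotopy X => ModuleCat.of A A) (ZerothHomotopy.mk x) := by
  have h := SSet.liftCycles_ιChainComplex_homologyπ_homology₀Iso_hom
    (TopCat.toSSet.obj (TopCat.of X)) (ModuleCat.of A A)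
      (TopCat.toSSetObj₀Equiv (X := TopCat.of X).symm x)
  -- The topological isomorphism is the simplicial one followed by relabelling components of the
  -- singular set as path components.
  have h' := congrArg (fun q => q ≫ ((sigmaConst.obj (ModuleCat.of A A)).map
    (TopCat.zerothHomotopyEquiv (X := TopCat.of X)).toIso.inv)) h
  simp only [Category.assoc] at h'
  have h3 : Sigma.ι (fun _ => ModuleCat.of A A)
      (SSet.π₀.mk (TopCat.toSSetObj₀Equiv (X := TopCat.of X).symm x)) ≫
      ((sigmaConst.obj (ModuleCat.of A A)).map
        (TopCat.zerothHomotopyEquiv (X := TopCat.of X)).toIso.inv) =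
      Sigma.ι (fun _ : ZerothHomotopy X => ModuleCat.of A A) (ZerothHomotopy.mk x) := by
    simp only [sigmaConst_obj_map]
    exact Sigma.ι_comp_map' _ _ _ |>.trans (Category.id_comp _)
  refine Eq.trans ?_ (h'.trans h3)
  rfl

theorem Hmap_pointClass {X Y : Type u} [TopologicalSpace X] [TopologicalSpace Y] (f : C(X, Y))
    (x : X) : pointClass A x ≫ ModuleCat.ofHom (Hmap A 0 f) = pointClass A (f x) :=
  vertexClass_homologyMap A (ModuleCat.of A A) (TopCat.toSSet.map (TopCat.ofHom f)) _

/-- Degree-zero homology is a coproduct of copies of A over the path components, and each summand is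
generated by the class of a point in it. -/
theorem singularHomology_zero_hom_ext {X : Type u} [TopologicalSpace X] {M : Type u}
    [AddCommGroup M] [Module A M] {f g : SingHomology A 0 X →ₗ[A] M}
    (h : ∀ x, f (pointClass A x (1 : A)) = g (pointClass A x (1 : A))) : f = g := by
  let e := TopCat.singularHomology₀Iso (TopCat.of X) (ModuleCat.of A A)
  have key : e.inv ≫ ModuleCat.ofHom f = e.inv ≫ ModuleCat.ofHom g := by
    refine Sigma.hom_ext _ _ fun s => ?_
    obtain ⟨x, rfl⟩ := ZerothHomotopy.mk_surjective s
    have := (Iso.eq_comp_inv e).2 (pointClass_singularHomology₀Iso A x)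
    erw [← reassoc_of% this, ← reassoc_of% this]
    refine ModuleCat.hom_ext (LinearMap.ext_ring ?_)
    exact h x
  exact congrArg ModuleCat.Hom.hom ((cancel_epi _).1 key)

theorem crossZero_pointClass (p : ℕ) {X Y : Type u} [TopologicalSpace X] [TopologicalSpace Y]
    (x : X) : crossZero A p X Y (pointClass A x (1 : A)) = Hmap A p (slice x) := by
  let F : ZerothHomotopy X → (ModuleCat.of A A ⟶
      ModuleCat.of A (SingHomology A p Y →ₗ[A] SingHomology A p (X × Y))) :=
    fun s => ModuleCat.ofHom (LinearMap.toSpanSingleton A _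
      (ZerothHomotopy.lift (fun x => Hmap A p (slice x))
        (fun _ _ γ => Hmap_eq_of_homotopy A p (sliceHomotopy γ)) s))
  have h : (pointClass A x ≫ (TopCat.singularHomology₀Iso (TopCat.of X) (ModuleCat.of A A)).hom) ≫
      Sigma.desc F = F (ZerothHomotopy.mk x) := by
    rw [pointClass_singularHomology₀Iso, Sigma.ι_desc]
  exact (congrArg (fun q => q.hom (1 : A)) h).trans (one_smul A _)

/-- With y fixed, both sides are linear in u, so point classes suffice. There the claim is that (f ×
h) ∘ `slice x` and `slice (f x)` ∘ h are the same map. -/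
theorem crossZero_naturality (p : ℕ) {X X' Y Y' : Type u} [TopologicalSpace X] [TopologicalSpace Y]
    [TopologicalSpace X'] [TopologicalSpace Y'] (f : C(X, X')) (h : C(Y, Y'))
    (u : SingHomology A 0 X) (y : SingHomology A p Y) :
    crossZero A p X' Y' (Hmap A 0 f u) (Hmap A p h y) =
      Hmap A p (f.prodMap h) (crossZero A p X Y u y) := by
  have key : ((crossZero A p X' Y').flip (Hmap A p h y)).comp (Hmap A 0 f) =
      (Hmap A p (f.prodMap h)).comp ((crossZero A p X Y).flip y) := by
    refine singularHomology_zero_hom_ext A fun x => ?_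
    have hx : Hmap A 0 f (pointClass A x (1 : A)) = pointClass A (f x) (1 : A) :=
      congrArg (fun q => q.hom (1 : A)) (Hmap_pointClass A f x)
    simp only [LinearMap.comp_apply, LinearMap.flip_apply]
    rw [hx, crossZero_pointClass, crossZero_pointClass, ← Hmap_comp_apply, ← Hmap_comp_apply]
    rfl
  exact LinearMap.congr_fun key u

variable {G : Type u} [Group G] {t : ℕ} {c : Fin t → ConjClasses G} {ξ : Fin t → ℕ}

/-- Conjugation acts entrywise on vectors and trivially on the join coordinate, so it passes through
concatenation. -/
theorem Hur.mul_smul_smul {m n : ℕ} (g : G) (z : Hur c ξ m) (w : Hur c ξ n) :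
    Hur.mul (g • z, g • w) = g • Hur.mul (z, w) := by
  obtain ⟨z, rfl⟩ := Hur.isOpenQuotientMap_mk.surjective z
  obtain ⟨w, rfl⟩ := Hur.isOpenQuotientMap_mk.surjective w
  refine congrArg Hur.mk (Prod.ext rfl (Subtype.ext (funext fun k => ?_)))
  have h := (Nat.add_mul m n (∑ i, ξ i)).symm
  change concat h (fun k => g * z.2.1 k * g⁻¹) (fun k => g * w.2.1 k * g⁻¹) k =
    g * concat h z.2.1 w.2.1 k * g⁻¹
  simp only [concat]
  split_ifs <;> rfl

theorem mulLeft_conj {d : ℕ} {U : componentRingDeg A c ξ d} {g : G}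
    (hU : Hmap A 0 (conjMap c ξ d g) U = U) (p n : ℕ) (y : SingHomology A p (Hur c ξ n)) :
    mulLeft A U p n (Hmap A p (conjMap c ξ n g) y) =
      Hmap A p (conjMap c ξ (d + n) g) (mulLeft A U p n y) := by
  simp only [mulLeft, LinearMap.comp_apply]
  -- Invariance lets U be replaced by its conjugate, so that g acts on both factors of the cross
  -- product and naturality applies.
  conv_lhs => rw [← hU]
  rw [crossZero_naturality, ← Hmap_comp_apply, ← Hmap_comp_apply]
  congr 2
  exact ContinuousMap.ext fun z => Hur.mul_smul_smul g z.1 z.2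

end Cross
end HurwitzSpace

/-! ### Linear algebra of a pair of transfers -/

namespace HurwitzSpace

/-- Both composites τπ and τ'π' are sums over G of the given operators, so φ intertwines them.
Together with the invertibility of |G| this makes π'φτ bijective. -/
theorem nonempty_equiv_of_transfer {A G : Type*} [Field A] [Fintype G]
    (hG : (Fintype.card G : A) ≠ 0) {M N M' N' : Type*} [AddCommGroup M] [AddCommGroup N]
    [AddCommGroup M'] [AddCommGroup N'] [Module A M] [Module A N] [Module A M'] [Module A N']
    {a : G → M →ₗ[A] M} {a' : G → M' →ₗ[A] M'} {π : M →ₗ[A] N} {π' : M' →ₗ[A] N'}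
    {τ : N →ₗ[A] M} {τ' : N' →ₗ[A] M'} (h₁ : ∀ y, π (τ y) = Fintype.card G • y)
    (h₂ : ∀ x, τ (π x) = ∑ g, a g x) (h₁' : ∀ y, π' (τ' y) = Fintype.card G • y)
    (h₂' : ∀ x, τ' (π' x) = ∑ g, a' g x) (φ : M →ₗ[A] M') (hφ : Function.Bijective φ)
    (hφa : ∀ g x, φ (a g x) = a' g (φ x)) : Nonempty (N ≃ₗ[A] N') := by
  have hφτ : ∀ x, φ (τ (π x)) = τ' (π' (φ x)) := fun x => by
    rw [h₂, h₂', map_sum]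
    simp only [hφa]
  refine ⟨LinearEquiv.ofBijective (π' ∘ₗ φ ∘ₗ τ) ⟨?_, fun y' => ?_⟩⟩
  · rw [← LinearMap.ker_eq_bot, LinearMap.ker_eq_bot']
    intro y hy
    -- Moving φ to the outside turns the left side into φ(τπτ y) = |G| φ(τ y). Hence τ y = 0, and
    -- then |G| y = πτ y = 0.
    have h : τ' (π' (φ (τ y))) = 0 := by
      rw [show π' (φ (τ y)) = 0 from hy, map_zero]
    rw [← hφτ, h₁, map_nsmul, map_nsmul, ← Nat.cast_smul_eq_nsmul A,
      smul_eq_zero_iff_right hG] at h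
    have h' : τ y = 0 := hφ.1 (h.trans (map_zero φ).symm)
    have h'' := h₁ y
    rw [h', map_zero, ← Nat.cast_smul_eq_nsmul A, eq_comm, smul_eq_zero_iff_right hG] at h''
    exact h''
  · obtain ⟨x, hx⟩ := hφ.2 (τ' y')
    -- With φ x = τ' y', the image of π x is π'φτπ x = π'τ'π'τ' y' = |G|² y', which fixes the
    -- scalar.
    refine ⟨((Fintype.card G : A) * Fintype.card G)⁻¹ • π x, ?_⟩
    rw [map_smul, LinearMap.comp_apply, LinearMap.comp_apply, hφτ, hx, h₁', h₁',
      ← Nat.cast_smul_eq_nsmul A, ← Nat.cast_smul_eq_nsmul A, smul_smul, smul_smul, mul_assoc,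
      inv_mul_cancel₀ (mul_ne_zero hG hG), one_smul]

end HurwitzSpace

/-! ### Stability for unmarked covers -/

theorem mainTheorem11 {G : Type u} [Group G] [Finite G] {t : ℕ}
    (c : Fin t → ConjClasses G) (hc : Function.Injective c) (hc1 : ∀ i, c i ≠ ConjClasses.mk 1)
    (ξ : Fin t → ℕ) (hξ : ∀ i, 0 < ξ i)
    (A : Type u) [Field A] (hA : ringChar A = 0 ∨ (ringChar A).Coprime (Nat.card G))
    (d : ℕ) (U : HurwitzSpace.componentRingDeg A c ξ d)
    (hU : ∀ g : G, HurwitzSpace.Hmap A 0 (HurwitzSpace.conjMap c ξ d g) U = U)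
    (r : ℕ → ℝ)
    (hstab : ∀ p n : ℕ, r p ≤ n → Function.Bijective (HurwitzSpace.mulLeft A U p n)) :
    ∀ p n : ℕ, r p ≤ n →
      Nonempty (HurwitzSpace.SingHomology A p (HurwitzSpace.UnmarkedHur c ξ n) ≃ₗ[A]
        HurwitzSpace.SingHomology A p (HurwitzSpace.UnmarkedHur c ξ (d + n))) := by
  intro p n hn
  have := Fintype.ofFinite G
  have hG : (Fintype.card G : A) ≠ 0 := by
    rw [← Nat.card_eq_fintype_card]
    intro h
    have hdvd := (ringChar.spec A _).1 h
    obtain h0 | hcop := hA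
    · rw [h0, zero_dvd_iff] at hdvd
      exact Nat.card_pos.ne' hdvd
    -- A characteristic both dividing |G| and coprime to it equals 1, which would force 1 = 0 in the
    -- field A.
    · have h1 := Nat.Coprime.eq_one_of_dvd hcop hdvd
      exact one_ne_zero ((Nat.cast_one (R := A)).symm.trans ((ringChar.spec A 1).2 (h1 ▸ dvd_rfl)))
  obtain ⟨τ, h₁, h₂⟩ := HurwitzSpace.exists_unmark_transfer (c := c) (ξ := ξ) (n := n) A p
  obtain ⟨τ', h₁', h₂'⟩ := HurwitzSpace.exists_unmark_transfer (c := c) (ξ := ξ) (n := d + n) A p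
  exact HurwitzSpace.nonempty_equiv_of_transfer hG h₁ h₂ h₁' h₂' (HurwitzSpace.mulLeft A U p n)
    (hstab p n hn)
    fun g x => HurwitzSpace.mulLeft_conj A (hU g) p n x
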